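/- Let $m>n\ge 1$, $y^*\in\mathbb R^m$, $\sigma>0$, let $\Pi\subset\mathbb R^n$ be convex and compact, and let $\Theta\subset\mathbb R^{m\times n}\times\mathbb R^m$ be compact. For $\theta=(A,b)$ consider the single-state affine system $$y_t=Ax_t+b+w_t,\qquad t=1,2,\dots,$$ where $x_t\in\mathbb R^n$ is the input, $y_t\in\mathbb R^m$ is the output, and the noise vectors $w_t\in\mathbb R^m$ are i.i.d. with a law $F$ in the class $\mathcal F$ of probability laws on $\mathbb R^m$ such that $\mathbb E\,w_{t,i}=0$, $\mathbb E\,w_{t,i}^2\le\sigma^2$ and $\mathbb E\,w_{t,i}^4\le\sigma^4$ for all $i$. For $A$ of full column rank, the stage cost $J_{\theta,F}(x)=\mathbb E\|y^*-(Ax+b+w_t)\|_2^2$ is minimized at the optimal input $x^*(\theta)=(A^{\mathsf T}A)^{-1}A^{\mathsf T}(y^*-b)$. Let $\Theta_0$ be the set of all $\theta=(A,b)\in\Theta$ such that $A$ has full column rank and $x^*(\theta)\in\Pi$, and assume that $\Theta_0$ has nonempty interior. A policy $\mu$ chooses each input $x_t^\mu\in\mathbb R^n$ as a measurable function of the past $(x_1,\dots,x_{t-1},y_1,\dots,y_{t-1})$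 and, possibly, of a random seed independent of the noise. A sequence of estimates $\hat x^\mu_t\in\mathbb R^n$ is any sequence of measurable functions of the same information. With expectations taken when $\mu$ is run on the system with parameter $\theta$ and noise law $F$, put $$\hat{\mathcal E}_T^\mu=\sup_{\theta\in\Theta_0,\,F\in\mathcal F}\mathbb E\sum_{t=1}^T\|\hat x_t^\mu-x^*(\theta)\|_2^2,\qquad \bar{\mathcal E}_T^\mu=\sup_{\theta\in\Theta_0,\,F\in\mathcal F}\mathbb E\sum_{t=1}^T\|x_t^\mu-x^*(\theta)\|_2^2,$$ $$\bar{\mathcal R}_T^\mu=\sup_{\theta\in\Theta_0,\,F\in\mathcal F}\mathbb E\Big(\sum_{t=1}^T J_{\theta,F}(x_t^\mu)-\sum_{t=1}^T J_{\theta,F}(x^*(\theta))\Big),$$ with values in $[0,\infty]$. Then there are constants $C,C',C''>0$ (depending only on $m,n,y^*,\sigma,\Pi,\Theta$) such that, for every policy $\mu$, every sequence of estimates $(\hat x_t^\mu)$ and every horizon $T$, $$\hat{\mathcal E}_T^\mu\,\bar{\mathcal E}_T^\mu\ge CT,\qquad \bar{\mathcal E}_T^\mu\ge C'\sqrt T,\qquad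 \bar{\mathcal R}_T^\mu\ge C''\sqrt T.$$ -/

import Mathlib

open MeasureTheory ProbabilityTheory Matrix
open scoped ENNReal

namespace AffineRegulation

noncomputable section

/-- The Euclidean space `ℝᵈ`. -/
abbrev Vec (d : ℕ) : Type := EuclideanSpace ℝ (Fin d)

/-- System parameters `θ = (A, b)` with `A ∈ ℝ^{m × n}` and `b ∈ ℝᵐ`. -/
abbrev Param (m n : ℕ) : Type := Matrix (Fin m) (Fin n) ℝ × Vec m

/-- The noiseless output `A x + b`. -/
def meanOutput {m n : ℕ} (θ : Param m n) (x : Vec n) : Vec m :=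
  WithLp.toLp 2 (θ.1 *ᵥ x.ofLp) + θ.2

/-- The optimal input `x*(θ) = (AᵀA)⁻¹ Aᵀ (y* - b)` of a decision maker who knows `θ`. -/
def optimalInput {m n : ℕ} (ystar : Vec m) (θ : Param m n) : Vec n :=
  WithLp.toLp 2 ((θ.1ᵀ * θ.1)⁻¹ *ᵥ (θ.1ᵀ *ᵥ (ystar - θ.2).ofLp))

/-- The parameters in `Θ` over which the worst case is taken: `A` has full column rank and the
optimal input lies in the set `D` known to the decision maker. -/
def admissibleParams {m n : ℕ} (ystar : Vec m) (D : Set (Vec n)) (Θ : Set (Param m n)) :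
    Set (Param m n) :=
  {θ | θ ∈ Θ ∧ θ.1.rank = n ∧ optimalInput ystar θ ∈ D}

/-- The noise laws: zero mean, second moment of every entry at most `σ²` and fourth moment of every
entry at most `σ⁴`. -/
def noiseLaws (m : ℕ) (σ : ℝ) : Set (ProbabilityMeasure (Vec m)) :=
  {F | ∀ i : Fin m,
    Integrable (fun w : Vec m => w i ^ 4) (F : Measure (Vec m)) ∧
    ∫ w, w i ∂(F : Measure (Vec m)) = 0 ∧
    ∫ w, w i ^ 2 ∂(F : Measure (Vec m)) ≤ σ ^ 2 ∧
    ∫ w, w i ^ 4 ∂(F : Measure (Vec m)) ≤ σ ^ 4}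

/-- A sequence of (possibly randomized) decision rules with values in `ℝⁿ`. The rule with index `t`
(period `t + 1`) sees the private random seed, drawn once from `S`, and the `t` input-output pairs
of the preceding periods. Policies and sequences of estimates are both of this form. -/
structure DecisionRules (m n : ℕ) (S : Type*) [MeasurableSpace S] where
  rule : (t : ℕ) → S → (Fin t → Vec n × Vec m) → Vec n
  measurable_rule : ∀ t, Measurable fun p : S × (Fin t → Vec n × Vec m) => rule t p.1 p.2

section Dynamics

variable {m n : ℕ} {S : Type*} [MeasurableSpace S]

/-- The first `t` input-output pairs when policy `μ` is run on the system `y = A x + b + w` with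
seed `u` and noise sequence `w`. -/
def history (μ : DecisionRules m n S) (θ : Param m n) (u : S) (w : ℕ → Vec m) :
    (t : ℕ) → Fin t → Vec n × Vec m
  | 0 => Fin.elim0
  | t + 1 =>
    Fin.snoc (α := fun _ => Vec n × Vec m) (history μ θ u w t)
      (μ.rule t u (history μ θ u w t),
        meanOutput θ (μ.rule t u (history μ θ u w t)) + w t)

/-- The value of the rules `e` at index `t` on the history generated by the policy `μ`. -/
def output (μ e : DecisionRules m n S) (θ : Param m n) (u : S) (w : ℕ → Vec m) (t : ℕ) : Vec n :=
  e.rule t u (history μ θ u w t)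

/-- Joint law of the seed and of the noise: the noise is i.i.d. with law `F` and independent of
the seed. -/
def jointLaw (ν : Measure S) (F : ProbabilityMeasure (Vec m)) : Measure (S × (ℕ → Vec m)) :=
  ν.prod (Measure.infinitePi fun _ : ℕ => (F : Measure (Vec m)))

/-- Expected cumulative squared distance to the optimal input, over `T` periods, of the estimates
`e` computed from the observations of policy `μ`. -/
def cumulativeMSE (ystar : Vec m) (ν : Measure S) (μ e : DecisionRules m n S) (T : ℕ)
    (θ : Param m n) (F : ProbabilityMeasure (Vec m)) : ℝ≥0∞ :=
  ∫⁻ ω, ∑ t ∈ Finset.range T,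
    ENNReal.ofReal (‖output μ e θ ω.1 ω.2 t - optimalInput ystar θ‖ ^ 2) ∂jointLaw ν F

/-- The stage cost `E ‖y* - y‖²` of the input `x`, where `y = A x + b + w` and `w` has law `F`. -/
def stageCost (ystar : Vec m) (θ : Param m n) (F : ProbabilityMeasure (Vec m)) (x : Vec n) : ℝ :=
  ∫ w, ‖ystar - (meanOutput θ x + w)‖ ^ 2 ∂(F : Measure (Vec m))

/-- The stage cost is the noiseless squared error plus the total variance of the noise. -/
theorem stageCost_eq {m n : ℕ} {σ : ℝ} (ystar : Vec m) (θ : Param m n)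
    {F : ProbabilityMeasure (Vec m)} (hF : F ∈ noiseLaws m σ) (x : Vec n) :
    stageCost ystar θ F x =
      ‖ystar - meanOutput θ x‖ ^ 2 + ∑ i, ∫ w, w i ^ 2 ∂(F : Measure (Vec m)) := by
  have hmeas : ∀ i : Fin m, AEStronglyMeasurable (fun w : Vec m => w i) (F : Measure (Vec m)) :=
    fun i => (by fun_prop : Measurable fun w : Vec m => w i).aestronglyMeasurable
  have h2 : ∀ i : Fin m, Integrable (fun w : Vec m => w i ^ 2) (F : Measure (Vec m)) := by
    intro i
    refine ((integrable_const (1 : ℝ)).add (hF i).1).mono ((hmeas i).pow 2) ?_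
    refine Filter.Eventually.of_forall fun w => ?_
    simp only [Pi.add_apply, Real.norm_eq_abs]
    rw [abs_of_nonneg (by positivity), abs_of_nonneg (by positivity)]
    nlinarith [sq_nonneg (w i ^ 2 - 1)]
  have h1 : ∀ i : Fin m, Integrable (fun w : Vec m => w i) (F : Measure (Vec m)) := by
    intro i
    refine ((integrable_const (1 : ℝ)).add (h2 i)).mono (hmeas i) ?_
    refine Filter.Eventually.of_forall fun w => ?_
    simp only [Pi.add_apply, Real.norm_eq_abs]
    rw [abs_of_nonneg (a := 1 + _) (by positivity)]
    exact abs_le.2 ⟨by nlinarith [sq_nonneg (w i + 1)], by nlinarith [sq_nonneg (w i - 1)]⟩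
  set v : Vec m := ystar - meanOutput θ x with hv
  have hpt : ∀ w : Vec m, ‖ystar - (meanOutput θ x + w)‖ ^ 2 =
      ∑ i, (v i ^ 2 - 2 * v i * w i + w i ^ 2) := by
    intro w
    rw [← sub_sub, ← hv, EuclideanSpace.real_norm_sq_eq]
    exact Finset.sum_congr rfl fun i _ => by simp only [PiLp.sub_apply]; ring
  have hi : ∀ i : Fin m, Integrable (fun w : Vec m => v i ^ 2 - 2 * v i * w i)
      (F : Measure (Vec m)) := fun i => (integrable_const _).sub ((h1 i).const_mul _)
  unfold stageCost
  simp only [hpt]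
  rw [integral_finsetSum _ fun i _ => Integrable.fun_add (hi i) (h2 i),
    EuclideanSpace.real_norm_sq_eq,
    ← Finset.sum_add_distrib]
  refine Finset.sum_congr rfl fun i _ => ?_
  rw [integral_add (hi i) (h2 i), integral_sub (integrable_const _) ((h1 i).const_mul _),
    integral_const_mul, (hF i).2.1]
  simp

/-- The optimal input minimizes the stage cost. -/
theorem stageCost_optimalInput_le {m n : ℕ} {σ : ℝ} (ystar : Vec m) (θ : Param m n)
    (hθ : θ.1.rank = n) {F : ProbabilityMeasure (Vec m)} (hF : F ∈ noiseLaws m σ) (x : Vec n) :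
    stageCost ystar θ F (optimalInput ystar θ) ≤ stageCost ystar θ F x := by
  rw [stageCost_eq ystar θ hF, stageCost_eq ystar θ hF]
  gcongr ?_ + _
  obtain ⟨A, b⟩ := θ
  simp only at hθ
  have hunit : IsUnit (Aᵀ * A).det := by
    have hr : (Aᵀ * A).rank = n := by rw [Matrix.rank_transpose_mul_self, hθ]
    rw [← Matrix.isUnit_iff_isUnit_det, ← Matrix.mulVec_surjective_iff_isUnit]
    exact LinearMap.range_eq_top.1 (Submodule.eq_top_of_finrank_eq
      (S := LinearMap.range (Aᵀ * A).mulVecLin) (by simpa [Matrix.rank] using hr))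
  set z := optimalInput ystar (A, b) with hz
  have hfoc : Aᵀ *ᵥ ((ystar - meanOutput (A, b) z).ofLp) = 0 := by
    have : (ystar - meanOutput (A, b) z).ofLp = (ystar - b).ofLp - A *ᵥ z.ofLp := by
      simp only [meanOutput, WithLp.ofLp_sub, WithLp.ofLp_add]; abel
    rw [this, Matrix.mulVec_sub, hz, optimalInput, Matrix.mulVec_mulVec,
      Matrix.mulVec_mulVec, Matrix.mul_nonsing_inv _ hunit, Matrix.one_mulVec, sub_self]
  have hdiff : ystar - meanOutput (A, b) x =
      (ystar - meanOutput (A, b) z) + WithLp.toLp 2 (A *ᵥ (z - x).ofLp) := by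
    simp only [meanOutput, WithLp.ofLp_sub, Matrix.mulVec_sub, WithLp.toLp_sub]; abel
  have horth : inner ℝ (ystar - meanOutput (A, b) z) (WithLp.toLp 2 (A *ᵥ (z - x).ofLp)) = 0 := by
    rw [EuclideanSpace.inner_eq_star_dotProduct, star_trivial, dotProduct_comm,
      Matrix.dotProduct_mulVec, ← Matrix.mulVec_transpose, hfoc, zero_dotProduct]
  rw [hdiff, norm_add_sq_real, horth]
  nlinarith [sq_nonneg ‖WithLp.toLp 2 (A *ᵥ (z - x).ofLp)‖]

/-- The regret: the expected excess over `T` periods of the cumulative stage cost of policy `μ` over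
that of the optimal input. The excess is nonnegative (`stageCost_optimalInput_le`), so
`ENNReal.ofReal` does not truncate. -/
def regret (ystar : Vec m) (ν : Measure S) (μ : DecisionRules m n S) (T : ℕ)
    (θ : Param m n) (F : ProbabilityMeasure (Vec m)) : ℝ≥0∞ :=
  ∫⁻ ω, ENNReal.ofReal
    (∑ t ∈ Finset.range T, stageCost ystar θ F (output μ μ θ ω.1 ω.2 t) -
      ∑ _t ∈ Finset.range T, stageCost ystar θ F (optimalInput ystar θ)) ∂jointLaw ν F

/-- The worst-case cumulative estimation-MSE of the estimates `e` under policy `μ`. -/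
def worstEstimationMSE (ystar : Vec m) (D : Set (Vec n)) (Θ : Set (Param m n)) (σ : ℝ)
    (ν : Measure S) (μ e : DecisionRules m n S) (T : ℕ) : ℝ≥0∞ :=
  ⨆ θ ∈ admissibleParams ystar D Θ, ⨆ F ∈ noiseLaws m σ, cumulativeMSE ystar ν μ e T θ F

/-- The worst-case cumulative input-MSE of policy `μ`. -/
def worstInputMSE (ystar : Vec m) (D : Set (Vec n)) (Θ : Set (Param m n)) (σ : ℝ)
    (ν : Measure S) (μ : DecisionRules m n S) (T : ℕ) : ℝ≥0∞ :=
  ⨆ θ ∈ admissibleParams ystar D Θ, ⨆ F ∈ noiseLaws m σ, cumulativeMSE ystar ν μ μ T θ F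

/-- The worst-case regret of policy `μ`. -/
def worstRegret (ystar : Vec m) (D : Set (Vec n)) (Θ : Set (Param m n)) (σ : ℝ)
    (ν : Measure S) (μ : DecisionRules m n S) (T : ℕ) : ℝ≥0∞ :=
  ⨆ θ ∈ admissibleParams ystar D Θ, ⨆ F ∈ noiseLaws m σ, regret ystar ν μ T θ F

end Dynamics

end

end AffineRegulation

namespace AffineRegulation

/-! ### Independence of the current noise from the past. -/

section Resampling

variable {m n : ℕ} {S : Type*} [MeasurableSpace S]

/-! The bound expresses a conflict between learning and regulation. Let `x₀` be the optimal input of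
an interior parameter `(A, b)` and `ρ` its residual there, which is orthogonal to the range of `A`.
Since `m > n`, the parameter can be chosen with `ρ ≠ 0`. Adding `s ρ vᵀ` to `A`, and correcting `b`
so that the mean output at `x₀` does not change, moves the optimal input at a linear rate in `s`
(`exists_hard_curve`), yet the mean output at `x` changes only by `s ⟨v, x - x₀⟩ ρ`. Inputs near the
optimum therefore carry almost no information about `s`.

Take Gaussian noise supported on the line through `ρ`. The information gathered by the policy is
then at most a constant times `s²` times its cumulative input error `X`. With `s²` of order `1 / X`
the systems `0` and `s` cannot be told apart in any of the `T` periods, so every estimate errs by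
order `s²` per period under one of the two (`two_point_bound`). Summation gives an estimation error
of order `T / X`, which is the product bound (`mse_mul_mse_ge`). Using the inputs themselves as
estimates gives the `√T` bound, and the regret dominates the input error uniformly along the curve.

The likelihood ratio of the two closed-loop systems comes from a Gaussian shift applied one period
at a time (`lintegral_history_change`). -/

theorem measurable_meanOutput (θ : Param m n) : Measurable (meanOutput θ) := by
  unfold meanOutput
  refine Continuous.measurable ?_
  fun_prop

theorem measurable_history (μ : DecisionRules m n S) (θ : Param m n) (t : ℕ) :
    Measurable fun p : S × (ℕ → Vec m) => history μ θ p.1 p.2 t := by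
  induction t with
  | zero => exact measurable_pi_iff.2 fun i => i.elim0
  | succ t ih =>
    have hr : Measurable fun p : S × (ℕ → Vec m) => μ.rule t p.1 (history μ θ p.1 p.2 t) :=
      (μ.measurable_rule t).comp (measurable_fst.prodMk ih)
    refine measurable_pi_iff.2 fun i => ?_
    refine Fin.lastCases ?_ (fun j => ?_) i
    · simp only [history, Fin.snoc_last]
      exact hr.prodMk (((measurable_meanOutput θ).comp hr).add
        ((measurable_pi_apply t).comp measurable_snd))
    · simp only [history, Fin.snoc_castSucc]
      exact (measurable_pi_apply j).comp ih

theorem measurable_output (μ e : DecisionRules m n S) (θ : Param m n) (t : ℕ) :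
    Measurable fun p : S × (ℕ → Vec m) => output μ e θ p.1 p.2 t :=
  (e.measurable_rule t).comp (measurable_fst.prodMk (measurable_history μ θ t))

/-- Nonanticipation: the first `s` pairs involve only noise of index below `s`. The case `s = t` is
included because the input at index `t` is chosen before `w t` is drawn. -/
theorem history_update (μ : DecisionRules m n S) (θ : Param m n) (u : S) (w : ℕ → Vec m)
    (t : ℕ) (z : Vec m) {s : ℕ} (hs : s ≤ t) :
    history μ θ u (Function.update w t z) s = history μ θ u w s := by
  induction s with
  | zero => rfl
  | succ s ih =>
    have h := ih (by omega)
    simp only [history, h]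
    rw [Function.update_of_ne (by omega)]

theorem output_update (μ e : DecisionRules m n S) (θ : Param m n) (u : S) (w : ℕ → Vec m)
    (t : ℕ) (z : Vec m) {s : ℕ} (hs : s ≤ t) :
    output μ e θ u (Function.update w t z) s = output μ e θ u w s := by
  rw [output, output, history_update μ θ u w t z hs]

instance (ν : Measure S) [IsProbabilityMeasure ν] (F : ProbabilityMeasure (Vec m)) :
    IsProbabilityMeasure (jointLaw ν F) := by
  unfold jointLaw; infer_instance

/-- Replacing the noise of one period by an independent copy preserves the joint law. -/
theorem measurePreserving_update (ν : Measure S) [IsProbabilityMeasure ν]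
    (F : ProbabilityMeasure (Vec m)) (t : ℕ) :
    MeasurePreserving
      (fun q : (S × (ℕ → Vec m)) × Vec m => (q.1.1, Function.update q.1.2 t q.2))
      ((jointLaw ν F).prod (F : Measure (Vec m))) (jointLaw ν F) := by
  set P : Measure (ℕ → Vec m) := Measure.infinitePi fun _ : ℕ => (F : Measure (Vec m)) with hP
  have hupd : Measurable fun q : (ℕ → Vec m) × Vec m => Function.update q.1 t q.2 :=
    measurable_update'
  have h1 : MeasurePreserving (fun q : (ℕ → Vec m) × Vec m => Function.update q.1 t q.2)
      (P.prod (F : Measure (Vec m))) P := by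
    refine ⟨hupd, ?_⟩
    rw [hP]
    refine Measure.eq_infinitePi _ fun s B hB => ?_
    rw [Measure.map_apply hupd (MeasurableSet.pi s.countable_toSet fun i _ => hB i)]
    -- The two laws are compared on finite boxes. If the box constrains coordinate `t`, its factor
    -- comes from the fresh copy; otherwise the fresh copy is unconstrained.
    by_cases hts : t ∈ s
    · have : (fun q : (ℕ → Vec m) × Vec m => Function.update q.1 t q.2) ⁻¹' (Set.pi s B) =
          (Set.pi (s.erase t) B) ×ˢ B t := by
        ext q
        simp only [Set.mem_preimage, Set.mem_pi, Finset.mem_coe, Set.mem_prod, Finset.mem_erase]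
        constructor
        · intro h
          refine ⟨fun i hi => ?_, ?_⟩
          · have := h i hi.2
            rwa [Function.update_of_ne hi.1] at this
          · have := h t hts
            rwa [Function.update_self] at this
        · rintro ⟨h, ht⟩ i hi
          by_cases hit : i = t
          · subst hit; rwa [Function.update_self]
          · rw [Function.update_of_ne hit]; exact h i ⟨hit, hi⟩
      rw [this, Measure.prod_prod, Measure.infinitePi_pi _ fun i _ => hB i,
        mul_comm, Finset.mul_prod_erase s (fun i => (F : Measure (Vec m)) (B i)) hts]
    · have : (fun q : (ℕ → Vec m) × Vec m => Function.update q.1 t q.2) ⁻¹' (Set.pi s B) =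
          (Set.pi s B) ×ˢ Set.univ := by
        ext q
        simp only [Set.mem_preimage, Set.mem_pi, Finset.mem_coe, Set.mem_prod, Set.mem_univ,
          and_true]
        refine forall₂_congr fun i hi => ?_
        rw [Function.update_of_ne (by rintro rfl; exact hts hi)]
      rw [this, Measure.prod_prod, Measure.infinitePi_pi _ fun i _ => hB i, measure_univ, mul_one]
  exact ((MeasurePreserving.id ν).prod h1).comp (measurePreserving_prodAssoc ν P _)

/-- Conditioning on the past: the current noise is replaced by an independent copy, to which Fubini
applies. -/
theorem lintegral_resample (ν : Measure S) [IsProbabilityMeasure ν]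
    (F : ProbabilityMeasure (Vec m)) (t : ℕ) {Φ : S × (ℕ → Vec m) → Vec m → ℝ≥0∞}
    (hΦ : Measurable (Function.uncurry Φ))
    (hup : ∀ u w z y, Φ (u, Function.update w t z) y = Φ (u, w) y) :
    ∫⁻ p, Φ p (p.2 t) ∂jointLaw ν F =
      ∫⁻ p, ∫⁻ z, Φ p z ∂(F : Measure (Vec m)) ∂jointLaw ν F := by
  have hm : Measurable fun p : S × (ℕ → Vec m) => Φ p (p.2 t) :=
    hΦ.comp (measurable_id.prodMk ((measurable_pi_apply t).comp measurable_snd))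
  rw [← (measurePreserving_update ν F t).lintegral_comp hm,
    lintegral_prod]
  · simp only [hup, Function.update_self]
  · exact (hm.comp (measurePreserving_update ν F t).measurable).aemeasurable

/-- A centred function of the current noise is uncorrelated with the past. -/
theorem integral_past_mul_noise (ν : Measure S) [IsProbabilityMeasure ν]
    (F : ProbabilityMeasure (Vec m)) (t : ℕ) {f : S × (ℕ → Vec m) → ℝ} {c : Vec m → ℝ}
    (hf : Integrable f (jointLaw ν F)) (hc : Integrable c (F : Measure (Vec m)))
    (hfm : Measurable f) (hcm : Measurable c)
    (hc0 : ∫ z, c z ∂(F : Measure (Vec m)) = 0)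
    (hup : ∀ u w z, f (u, Function.update w t z) = f (u, w)) :
    Integrable (fun p => f p * c (p.2 t)) (jointLaw ν F) ∧
      ∫ p, f p * c (p.2 t) ∂jointLaw ν F = 0 := by
  have hmp := measurePreserving_update ν F t
  have hm : AEStronglyMeasurable (fun p : S × (ℕ → Vec m) => f p * c (p.2 t)) (jointLaw ν F) :=
    (hfm.mul (hcm.comp ((measurable_pi_apply t).comp measurable_snd))).aestronglyMeasurable
  have heq : (fun p : S × (ℕ → Vec m) => f p * c (p.2 t)) ∘
      (fun q : (S × (ℕ → Vec m)) × Vec m => (q.1.1, Function.update q.1.2 t q.2)) =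
      fun q => f q.1 * c q.2 := by
    funext q; simp [hup]
  constructor
  · rw [← hmp.integrable_comp hm, heq]
    exact hf.mul_prod hc
  · rw [← hmp.map_eq, integral_map hmp.measurable.aemeasurable (by rwa [hmp.map_eq])]
    change ∫ q, ((fun p : S × (ℕ → Vec m) => f p * c (p.2 t)) ∘
      (fun q : (S × (ℕ → Vec m)) × Vec m => (q.1.1, Function.update q.1.2 t q.2))) q ∂_ = 0
    rw [heq, integral_prod_mul, hc0, mul_zero]

end Resampling

/-! ### Gaussian noise on a line: shifts and moment bounds. -/

section GaussianNoise

variable {m : ℕ}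

/-- The weight is the density of `N(a, 1)` with respect to `N(0, 1)`. -/
theorem lintegral_gaussianReal_shift (a : ℝ) {f : ℝ → ℝ≥0∞} (hf : Measurable f) :
    ∫⁻ z, f (a + z) ∂gaussianReal 0 1 =
      ∫⁻ z, f z * ENNReal.ofReal (Real.exp (a * z - a ^ 2 / 2)) ∂gaussianReal 0 1 := by
  have h1 : ∫⁻ z, f (a + z) ∂gaussianReal 0 1 = ∫⁻ z, f z ∂gaussianReal a 1 := by
    have := gaussianReal_map_const_add (μ := 0) (v := 1) a
    rw [zero_add] at this
    rw [← this, lintegral_map hf (by fun_prop)]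
  rw [h1, gaussianReal_of_var_ne_zero _ one_ne_zero, gaussianReal_of_var_ne_zero _ one_ne_zero,
    lintegral_withDensity_eq_lintegral_mul _ (measurable_gaussianPDF _ _) hf,
    lintegral_withDensity_eq_lintegral_mul _ (measurable_gaussianPDF _ _) (by fun_prop)]
  refine lintegral_congr fun z => ?_
  simp only [Pi.mul_apply, gaussianPDF, gaussianPDFReal]
  rw [mul_comm (f z), ← mul_assoc, ← ENNReal.ofReal_mul (by positivity), mul_assoc (√_)⁻¹,
    ← Real.exp_add]
  have : -(z - a) ^ 2 / (2 * ((1 : NNReal) : ℝ)) =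
      -(z - 0) ^ 2 / (2 * ((1 : NNReal) : ℝ)) + (a * z - a ^ 2 / 2) := by
    rw [NNReal.coe_one]; ring
  rw [this]

/-- The law of `z ρ` with `z` standard normal. -/
noncomputable def lineGaussian (ρ : Vec m) : ProbabilityMeasure (Vec m) :=
  ⟨(gaussianReal 0 1).map fun z : ℝ => z • ρ,
    Measure.isProbabilityMeasure_map (by fun_prop)⟩

/-- The coefficient of `ρ` in the orthogonal projection of `w` onto the line spanned by `ρ`. -/
noncomputable def lineCoord (ρ w : Vec m) : ℝ := inner ℝ ρ w / ‖ρ‖ ^ 2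

theorem lineCoord_smul {ρ : Vec m} (hρ : ρ ≠ 0) (z : ℝ) : lineCoord ρ (z • ρ) = z := by
  rw [lineCoord, inner_smul_right, real_inner_self_eq_norm_sq, mul_div_assoc,
    div_self (by simpa using hρ), mul_one]

theorem measurable_lineCoord (ρ : Vec m) : Measurable (lineCoord ρ) := by
  unfold lineCoord
  exact Continuous.measurable (by fun_prop)

theorem lintegral_lineGaussian (ρ : Vec m) {f : Vec m → ℝ≥0∞} (hf : Measurable f) :
    ∫⁻ w, f w ∂(lineGaussian ρ : Measure (Vec m)) = ∫⁻ z, f (z • ρ) ∂gaussianReal 0 1 := by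
  change ∫⁻ w, f w ∂((gaussianReal 0 1).map fun z : ℝ => z • ρ) = _
  rw [lintegral_map hf (by fun_prop)]

theorem integral_lineGaussian (ρ : Vec m) {f : Vec m → ℝ} (hf : Measurable f) :
    ∫ w, f w ∂(lineGaussian ρ : Measure (Vec m)) = ∫ z, f (z • ρ) ∂gaussianReal 0 1 := by
  change ∫ w, f w ∂((gaussianReal 0 1).map fun z : ℝ => z • ρ) = _
  rw [integral_map (by fun_prop) hf.aestronglyMeasurable]

theorem integrable_lineGaussian_iff (ρ : Vec m) {f : Vec m → ℝ} (hf : Measurable f) :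
    Integrable f (lineGaussian ρ : Measure (Vec m)) ↔
      Integrable (fun z : ℝ => f (z • ρ)) (gaussianReal 0 1) := by
  change Integrable f ((gaussianReal 0 1).map fun z : ℝ => z • ρ) ↔ _
  rw [integrable_map_measure hf.aestronglyMeasurable (by fun_prop)]
  rfl

theorem lintegral_lineGaussian_shift {ρ : Vec m} (hρ : ρ ≠ 0) (a : ℝ) {f : Vec m → ℝ≥0∞}
    (hf : Measurable f) :
    ∫⁻ w, f (a • ρ + w) ∂(lineGaussian ρ : Measure (Vec m)) =
      ∫⁻ w, f w * ENNReal.ofReal (Real.exp (a * lineCoord ρ w - a ^ 2 / 2))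
        ∂(lineGaussian ρ : Measure (Vec m)) := by
  have hl := measurable_lineCoord ρ
  rw [lintegral_lineGaussian ρ (by fun_prop), lintegral_lineGaussian ρ (by fun_prop)]
  simp only [← add_smul, lineCoord_smul hρ]
  exact lintegral_gaussianReal_shift a (f := fun z => f (z • ρ)) (by fun_prop)

theorem integrable_pow_gaussianReal (k : ℕ) :
    Integrable (fun z : ℝ => z ^ k) (gaussianReal 0 1) := by
  rcases Nat.eq_zero_or_pos k with rfl | hk
  · simp
  · have := (memLp_id_gaussianReal (μ := 0) (v := 1) (k : NNReal))
    have h2 := this.integrable_norm_rpow (by simpa using hk.ne') (by simp)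
    refine h2.mono (by fun_prop) (Filter.Eventually.of_forall fun z => ?_)
    simp

theorem integrable_lineCoord {ρ : Vec m} (hρ : ρ ≠ 0) :
    Integrable (lineCoord ρ) (lineGaussian ρ : Measure (Vec m)) := by
  rw [integrable_lineGaussian_iff ρ (measurable_lineCoord ρ)]
  simpa only [lineCoord_smul hρ, pow_one] using integrable_pow_gaussianReal 1

theorem integral_lineCoord {ρ : Vec m} (hρ : ρ ≠ 0) :
    ∫ w, lineCoord ρ w ∂(lineGaussian ρ : Measure (Vec m)) = 0 := by
  rw [integral_lineGaussian ρ (measurable_lineCoord ρ)]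
  simp only [lineCoord_smul hρ, integral_id_gaussianReal]

/-- The law of `z τ ρ`, with `z` standard normal, satisfies the moment bounds for some `τ > 0`. -/
theorem exists_lineGaussian_mem_noiseLaws (ρ : Vec m) {σ : ℝ} (hσ : 0 < σ) :
    ∃ τ : ℝ, 0 < τ ∧ lineGaussian (τ • ρ) ∈ noiseLaws m σ := by
  set M : ℝ := 1 + ∫ z, z ^ 2 ∂gaussianReal 0 1 + ∫ z, z ^ 4 ∂gaussianReal 0 1 with hM
  have h2 : 0 ≤ ∫ z, z ^ 2 ∂gaussianReal 0 1 := integral_nonneg fun z => by positivity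
  have h4 : 0 ≤ ∫ z, z ^ 4 ∂gaussianReal 0 1 := integral_nonneg fun z => by positivity
  have hM1 : 1 ≤ M := by rw [hM]; linarith
  -- `M` is at least `1` and dominates the second and fourth normal moments, so `|τ ρ i| * M ≤ σ`
  -- yields both moment bounds through `M ≤ M ^ k`. The summand `1` in `1 + ‖ρ‖` covers `ρ = 0`.
  set τ : ℝ := σ / (M * (1 + ‖ρ‖)) with hτ
  have hden : 0 < M * (1 + ‖ρ‖) := by positivity
  have hτ0 : 0 < τ := by positivity
  refine ⟨τ, hτ0, fun i => ?_⟩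
  have hc : |τ * ρ i| * M ≤ σ := by
    have h := PiLp.norm_apply_le ρ i
    rw [Real.norm_eq_abs] at h
    rw [abs_mul, abs_of_pos hτ0]
    calc τ * |ρ i| * M ≤ τ * (1 + ‖ρ‖) * M := by gcongr; linarith
      _ = σ := by rw [hτ]; field_simp
  have hmk : ∀ k : ℕ, Measurable fun w : Vec m => w i ^ k := fun k => by fun_prop
  have hk : ∀ (k : ℕ) (z : ℝ), (z • τ • ρ) i ^ k = (τ * ρ i) ^ k * z ^ k := by
    intro k z; simp only [PiLp.smul_apply, smul_eq_mul]; ring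
  have hi : ∀ k : ℕ, ∫ w, w i ^ k ∂(lineGaussian (τ • ρ) : Measure (Vec m)) =
      (τ * ρ i) ^ k * ∫ z, z ^ k ∂gaussianReal 0 1 := by
    intro k
    rw [integral_lineGaussian _ (hmk k)]
    simp only [hk, integral_const_mul]
  have hbound : ∀ k : ℕ, Even k → k ≠ 0 → ∫ z, z ^ k ∂gaussianReal 0 1 ≤ M →
      (τ * ρ i) ^ k * ∫ z, z ^ k ∂gaussianReal 0 1 ≤ σ ^ k := by
    intro k hke hk0 hkM
    calc (τ * ρ i) ^ k * ∫ z, z ^ k ∂gaussianReal 0 1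
        ≤ |τ * ρ i| ^ k * M ^ k := by
          rw [hke.pow_abs]
          have : 0 ≤ (τ * ρ i) ^ k := hke.pow_nonneg _
          gcongr
          exact hkM.trans (le_self_pow₀ hM1 hk0)
      _ = (|τ * ρ i| * M) ^ k := (mul_pow _ _ _).symm
      _ ≤ σ ^ k := by gcongr
  refine ⟨?_, ?_, ?_, ?_⟩
  · rw [integrable_lineGaussian_iff _ (hmk 4)]
    simp only [hk]
    exact (integrable_pow_gaussianReal 4).const_mul _
  · have := hi 1
    simp only [pow_one, integral_id_gaussianReal, mul_zero] at this
    exact this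
  · rw [hi]; exact hbound 2 (by decide) (by norm_num) (by rw [hM]; linarith)
  · rw [hi]; exact hbound 4 (by decide) (by norm_num) (by rw [hM]; linarith)

end GaussianNoise

/-! ### Likelihood ratios of closed-loop systems and the two-point method. -/

section ChangeOfMeasure

variable {m n : ℕ} {S : Type*} [MeasurableSpace S]

/-- The log-likelihood ratio, after `t` periods, of the system whose output exceeds that of `θ` by
`g x • ρ` with respect to the system `θ`, when the noise has law `lineGaussian ρ`. -/
noncomputable def logLikelihood (g : Vec n → ℝ) (ρ : Vec m) (μ : DecisionRules m n S)
    (θ : Param m n) (t : ℕ) (p : S × (ℕ → Vec m)) : ℝ :=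
  ∑ i ∈ Finset.range t, (g (output μ μ θ p.1 p.2 i) * lineCoord ρ (p.2 i) -
    g (output μ μ θ p.1 p.2 i) ^ 2 / 2)

theorem measurable_logLikelihood {g : Vec n → ℝ} (hg : Measurable g) (ρ : Vec m)
    (μ : DecisionRules m n S) (θ : Param m n) (t : ℕ) :
    Measurable (logLikelihood g ρ μ θ t) := by
  refine Finset.measurable_sum _ fun i _ => ?_
  have h := hg.comp (measurable_output μ μ θ i)
  exact (h.mul ((measurable_lineCoord ρ).comp ((measurable_pi_apply i).comp measurable_snd))).sub
    ((h.pow_const 2).div_const 2)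

theorem logLikelihood_update (g : Vec n → ℝ) (ρ : Vec m) (μ : DecisionRules m n S)
    (θ : Param m n) (u : S) (w : ℕ → Vec m) (t : ℕ) (z : Vec m) :
    logLikelihood g ρ μ θ t (u, Function.update w t z) = logLikelihood g ρ μ θ t (u, w) := by
  refine Finset.sum_congr rfl fun i hi => ?_
  have hit : i < t := Finset.mem_range.1 hi
  simp only [output_update μ μ θ u w t z hit.le, Function.update_of_ne hit.ne]

theorem measurable_snoc (t : ℕ) :
    Measurable fun q : (Fin t → Vec n × Vec m) × (Vec n × Vec m) =>
      (Fin.snoc (α := fun _ => Vec n × Vec m) q.1 q.2 : Fin (t + 1) → Vec n × Vec m) := by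
  refine measurable_pi_iff.2 fun i => Fin.lastCases ?_ (fun j => ?_) i
  · simpa only [Fin.snoc_last] using measurable_snd
  · simp only [Fin.snoc_castSucc]
    exact (measurable_pi_apply j).comp measurable_fst

/-- The expectation of a function of the seed and of the history under the system `θ₁`, as an
expectation under the system `θ₀`. -/
theorem lintegral_history_change (ν : Measure S) [IsProbabilityMeasure ν]
    (μ : DecisionRules m n S) {θ₀ θ₁ : Param m n} {ρ : Vec m} (hρ : ρ ≠ 0) {g : Vec n → ℝ}
    (hg : Measurable g) (hθ : ∀ x, meanOutput θ₁ x = meanOutput θ₀ x + g x • ρ) (t : ℕ)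
    {G : S × (Fin t → Vec n × Vec m) → ℝ≥0∞} (hG : Measurable G) :
    ∫⁻ p, G (p.1, history μ θ₁ p.1 p.2 t) ∂jointLaw ν (lineGaussian ρ) =
      ∫⁻ p, G (p.1, history μ θ₀ p.1 p.2 t) *
        ENNReal.ofReal (Real.exp (logLikelihood g ρ μ θ₀ t p)) ∂jointLaw ν (lineGaussian ρ) := by
  induction t with
  | zero => simp [logLikelihood, history]
  | succ t ih =>
    set F := lineGaussian ρ with hF
    have hl := measurable_lineCoord ρ
    -- the value of `G` after one more step with the mean output of `θ`
    let Ψ : Param m n → S × (Fin t → Vec n × Vec m) → Vec m → ℝ≥0∞ := fun θ q z =>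
      G (q.1, Fin.snoc (α := fun _ => Vec n × Vec m) q.2
        (μ.rule t q.1 q.2, meanOutput θ (μ.rule t q.1 q.2) + z))
    have hΨ : ∀ θ, Measurable fun r : (S × (Fin t → Vec n × Vec m)) × Vec m => Ψ θ r.1 r.2 := by
      intro θ
      have hr : Measurable fun r : (S × (Fin t → Vec n × Vec m)) × Vec m =>
          μ.rule t r.1.1 r.1.2 := (μ.measurable_rule t).comp measurable_fst
      exact hG.comp ((measurable_fst.comp measurable_fst).prodMk ((measurable_snoc t).comp
        ((measurable_snd.comp measurable_fst).prodMk
          (hr.prodMk (((measurable_meanOutput θ).comp hr).add measurable_snd)))))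
    have hh : ∀ θ, Measurable fun p : S × (ℕ → Vec m) => (p.1, history μ θ p.1 p.2 t) :=
      fun θ => measurable_fst.prodMk (measurable_history μ θ t)
    have hlr : Measurable fun r : (S × (Fin t → Vec n × Vec m)) × Vec m =>
        ENNReal.ofReal (Real.exp (g (μ.rule t r.1.1 r.1.2) * lineCoord ρ r.2 -
          g (μ.rule t r.1.1 r.1.2) ^ 2 / 2)) := by
      have hr : Measurable fun r : (S × (Fin t → Vec n × Vec m)) × Vec m =>
          g (μ.rule t r.1.1 r.1.2) := hg.comp ((μ.measurable_rule t).comp measurable_fst)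
      have hr2 : Measurable fun r : (S × (Fin t → Vec n × Vec m)) × Vec m => lineCoord ρ r.2 :=
        hl.comp measurable_snd
      exact ((hr.mul hr2).sub ((hr.pow_const 2).div_const 2)).exp.ennreal_ofReal
    calc ∫⁻ p, G (p.1, history μ θ₁ p.1 p.2 (t + 1)) ∂jointLaw ν F
        = ∫⁻ p, (fun p z => Ψ θ₁ (p.1, history μ θ₁ p.1 p.2 t) z) p (p.2 t) ∂jointLaw ν F := rfl
      _ = ∫⁻ p, ∫⁻ z, Ψ θ₁ (p.1, history μ θ₁ p.1 p.2 t) z ∂(F : Measure (Vec m))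
            ∂jointLaw ν F := by
          refine lintegral_resample ν F t ?_ fun u w z y => ?_
          · exact (hΨ θ₁).comp (((hh θ₁).comp measurable_fst).prodMk measurable_snd)
          · simp only [history_update μ θ₁ u w t z le_rfl]
      -- With the last noise averaged out, the integrand depends only on the seed and the first `t`
      -- pairs, so the induction hypothesis applies.
      _ = ∫⁻ p, (∫⁻ z, Ψ θ₁ (p.1, history μ θ₀ p.1 p.2 t) z ∂(F : Measure (Vec m))) *
            ENNReal.ofReal (Real.exp (logLikelihood g ρ μ θ₀ t p)) ∂jointLaw ν F :=
          ih (G := fun q => ∫⁻ z, Ψ θ₁ q z ∂(F : Measure (Vec m)))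
            (Measurable.lintegral_prod_right' (hΨ θ₁))
      _ = ∫⁻ p, ∫⁻ z, (fun p z => Ψ θ₀ (p.1, history μ θ₀ p.1 p.2 t) z *
            ENNReal.ofReal (Real.exp (g (output μ μ θ₀ p.1 p.2 t) * lineCoord ρ z -
              g (output μ μ θ₀ p.1 p.2 t) ^ 2 / 2)) *
            ENNReal.ofReal (Real.exp (logLikelihood g ρ μ θ₀ t p))) p z
            ∂(F : Measure (Vec m)) ∂jointLaw ν F := by
          -- For a fixed past the next input is fixed, so the two systems differ in the next output
          -- by a deterministic multiple of `ρ`, and the Gaussian shift produces the new likelihood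
          -- factor.
          refine lintegral_congr fun p => ?_
          set q := (p.1, history μ θ₀ p.1 p.2 t) with hq
          have hx : ∀ z, Ψ θ₁ q z = Ψ θ₀ q (g (μ.rule t q.1 q.2) • ρ + z) := by
            intro z; simp only [Ψ, hθ, add_assoc]
          have hm : Measurable fun z => Ψ θ₀ q z := (hΨ θ₀).comp measurable_prodMk_left
          simp only [hx]
          rw [lintegral_lineGaussian_shift hρ _ hm, lintegral_mul_const]
          · rfl
          · exact hm.mul (hlr.comp (measurable_prodMk_left (x := q)))
      _ = ∫⁻ p, Ψ θ₀ (p.1, history μ θ₀ p.1 p.2 t) (p.2 t) *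
            ENNReal.ofReal (Real.exp (g (output μ μ θ₀ p.1 p.2 t) * lineCoord ρ (p.2 t) -
              g (output μ μ θ₀ p.1 p.2 t) ^ 2 / 2)) *
            ENNReal.ofReal (Real.exp (logLikelihood g ρ μ θ₀ t p)) ∂jointLaw ν F := by
          refine (lintegral_resample ν F t ?_ fun u w z y => ?_).symm
          · have hc : Measurable fun r : (S × (ℕ → Vec m)) × Vec m =>
                ((r.1.1, history μ θ₀ r.1.1 r.1.2 t), r.2) :=
              ((hh θ₀).comp measurable_fst).prodMk measurable_snd
            exact (((hΨ θ₀).comp hc).mul (hlr.comp hc)).mul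
              ((measurable_logLikelihood hg ρ μ θ₀ t).comp measurable_fst).exp.ennreal_ofReal
          · simp only [history_update μ θ₀ u w t z le_rfl, output_update μ μ θ₀ u w t z le_rfl,
              logLikelihood_update]
      _ = _ := by
          refine lintegral_congr fun p => ?_
          rw [mul_assoc, ← ENNReal.ofReal_mul (Real.exp_nonneg _), ← Real.exp_add, add_comm,
            logLikelihood, logLikelihood, Finset.sum_range_succ]
          rfl

/-- With `r = exp (x / 2)` this combines `r - (1 + r ^ 2) / 4 ≤ min 1 (r ^ 2)` with `1 + x / 2 ≤ r`.
It bounds the overlap of two laws using only the means of the likelihood ratio and of its logarithm.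
-/
theorem le_min_one_exp (x : ℝ) :
    1 + x / 2 - (1 + Real.exp x) / 4 ≤ min 1 (Real.exp x) := by
  have h := Real.add_one_le_exp (x / 2)
  have h2 : Real.exp x = Real.exp (x / 2) ^ 2 := by rw [← Real.exp_nat_mul]; congr 1; push_cast; ring
  rw [h2]
  set r := Real.exp (x / 2)
  refine le_min ?_ ?_ <;> nlinarith [sq_nonneg (r / 2 - 1), sq_nonneg (r - 1 / 2)]

/-- Two systems whose accumulated information is at most `1 / 2` cannot be told apart. -/
theorem lintegral_min_likelihood_ge (ν : Measure S) [IsProbabilityMeasure ν]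
    (μ : DecisionRules m n S) {θ₀ θ₁ : Param m n} {ρ : Vec m} (hρ : ρ ≠ 0) {g : Vec n → ℝ}
    (hg : Measurable g) (hθ : ∀ x, meanOutput θ₁ x = meanOutput θ₀ x + g x • ρ) (t : ℕ)
    (hinfo : ∫⁻ p, ∑ i ∈ Finset.range t, ENNReal.ofReal (g (output μ μ θ₀ p.1 p.2 i) ^ 2)
      ∂jointLaw ν (lineGaussian ρ) ≤ 1) :
    ENNReal.ofReal (1 / 4) ≤ ∫⁻ p, ENNReal.ofReal
      (min 1 (Real.exp (logLikelihood g ρ μ θ₀ t p))) ∂jointLaw ν (lineGaussian ρ) := by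
  set P := jointLaw ν (lineGaussian ρ) with hP
  set Λ := logLikelihood g ρ μ θ₀ t with hΛ
  have hΛm : Measurable Λ := measurable_logLikelihood hg ρ μ θ₀ t
  have hgm : ∀ i, Measurable fun p : S × (ℕ → Vec m) => g (output μ μ θ₀ p.1 p.2 i) :=
    fun i => hg.comp (measurable_output μ μ θ₀ i)
  -- the likelihood ratio has mean one
  have hLint : ∫⁻ p, ENNReal.ofReal (Real.exp (Λ p)) ∂P = 1 := by
    have h := lintegral_history_change ν μ hρ hg hθ t (G := fun _ => 1) measurable_const
    simpa using h.symm
  have hLi : Integrable (fun p => Real.exp (Λ p)) P := by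
    refine ⟨hΛm.exp.aestronglyMeasurable, ?_⟩
    rw [hasFiniteIntegral_iff_ofReal (Filter.Eventually.of_forall fun p => Real.exp_nonneg _),
      hLint]
    exact ENNReal.one_lt_top
  have hL1 : ∫ p, Real.exp (Λ p) ∂P = 1 := by
    rw [integral_eq_lintegral_of_nonneg_ae
      (Filter.Eventually.of_forall fun p => Real.exp_nonneg _) hΛm.exp.aestronglyMeasurable, hLint]
    simp
  -- the squared information increments are integrable
  set Q : S × (ℕ → Vec m) → ℝ := fun p =>
    ∑ i ∈ Finset.range t, g (output μ μ θ₀ p.1 p.2 i) ^ 2 with hQ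
  have hQm : Measurable Q := Finset.measurable_sum _ fun i _ => (hgm i).pow_const 2
  have hQ0 : ∀ p, 0 ≤ Q p := fun p => Finset.sum_nonneg fun i _ => sq_nonneg _
  have hQl : ∫⁻ p, ENNReal.ofReal (Q p) ∂P ≤ 1 := by
    refine le_trans (le_of_eq ?_) hinfo
    exact lintegral_congr fun p => ENNReal.ofReal_sum_of_nonneg fun i _ => sq_nonneg _
  have hQi : Integrable Q P := by
    refine ⟨hQm.aestronglyMeasurable, ?_⟩
    rw [hasFiniteIntegral_iff_ofReal (Filter.Eventually.of_forall hQ0)]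
    exact hQl.trans_lt ENNReal.one_lt_top
  have hQ1 : ∫ p, Q p ∂P ≤ 1 := by
    rw [integral_eq_lintegral_of_nonneg_ae (Filter.Eventually.of_forall hQ0)
      hQm.aestronglyMeasurable]
    exact ENNReal.toReal_le_of_le_ofReal zero_le_one (by simpa using hQl)
  have hmart : ∀ i ∈ Finset.range t,
      Integrable (fun p : S × (ℕ → Vec m) =>
        g (output μ μ θ₀ p.1 p.2 i) * lineCoord ρ (p.2 i)) P ∧
      ∫ p, g (output μ μ θ₀ p.1 p.2 i) * lineCoord ρ (p.2 i) ∂P = 0 := by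
    intro i hi
    have hgi : Integrable (fun p : S × (ℕ → Vec m) => g (output μ μ θ₀ p.1 p.2 i)) P := by
      refine ((integrable_const (1 : ℝ)).add hQi).mono (hgm i).aestronglyMeasurable
        (Filter.Eventually.of_forall fun p => ?_)
      have h1 : g (output μ μ θ₀ p.1 p.2 i) ^ 2 ≤ Q p :=
        Finset.single_le_sum (f := fun i => g (output μ μ θ₀ p.1 p.2 i) ^ 2)
          (fun i _ => sq_nonneg _) hi
      have h0 := hQ0 p
      simp only [Pi.add_apply, Real.norm_eq_abs]
      rw [abs_of_nonneg (a := 1 + Q p) (by linarith)]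
      exact abs_le.2 ⟨by nlinarith [sq_nonneg (g (output μ μ θ₀ p.1 p.2 i) + 1)],
        by nlinarith [sq_nonneg (g (output μ μ θ₀ p.1 p.2 i) - 1)]⟩
    exact integral_past_mul_noise ν (lineGaussian ρ) i hgi (integrable_lineCoord hρ) (hgm i)
      (measurable_lineCoord ρ) (integral_lineCoord hρ)
      fun u w z => by simp only [output_update μ μ θ₀ u w i z le_rfl]
  have hΛeq : Λ = fun p => (∑ i ∈ Finset.range t,
      g (output μ μ θ₀ p.1 p.2 i) * lineCoord ρ (p.2 i)) - Q p / 2 := by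
    funext p
    simp only [hΛ, hQ, logLikelihood, Finset.sum_sub_distrib, Finset.sum_div]
  have hMi := integrable_finsetSum (Finset.range t) fun i hi => (hmart i hi).1
  have hΛi : Integrable Λ P := by
    rw [hΛeq]; exact hMi.sub (hQi.div_const 2)
  -- The noise terms are centred given the past, so the mean of `Λ` is minus half the mean of `Q`.
  have hΛint : -(1 / 2) ≤ ∫ p, Λ p ∂P := by
    rw [hΛeq, integral_sub hMi (hQi.div_const 2),
      integral_finsetSum _ fun i hi => (hmart i hi).1, Finset.sum_eq_zero fun i hi => (hmart i hi).2,
      integral_div]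
    linarith
  have hmin0 : ∀ p, 0 ≤ min 1 (Real.exp (Λ p)) := fun p => le_min zero_le_one (Real.exp_nonneg _)
  have hminm : Measurable fun p => min 1 (Real.exp (Λ p)) := measurable_const.min hΛm.exp
  have hmini : Integrable (fun p => min 1 (Real.exp (Λ p))) P :=
    (integrable_const (1 : ℝ)).mono hminm.aestronglyMeasurable
      (Filter.Eventually.of_forall fun p => by
        rw [Real.norm_of_nonneg (hmin0 p)]; simp)
  have hlow : Integrable (fun p => 1 + Λ p / 2 - (1 + Real.exp (Λ p)) / 4) P :=
    ((integrable_const (1 : ℝ)).add (hΛi.div_const 2)).sub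
      (((integrable_const (1 : ℝ)).add hLi).div_const 4)
  rw [← ofReal_integral_eq_lintegral_ofReal hmini (Filter.Eventually.of_forall hmin0)]
  refine ENNReal.ofReal_le_ofReal ?_
  refine le_trans ?_ (integral_mono hlow hmini fun p => le_min_one_exp (Λ p))
  -- Numerically, `1 - (1 / 2) / 2 - (1 + 1) / 4 = 1 / 4`.
  rw [integral_sub, integral_add, integral_div, integral_div, integral_add, hL1]
  · simp only [integral_const, probReal_univ, smul_eq_mul, mul_one]
    linarith
  · exact integrable_const _
  · exact hLi
  · exact integrable_const _
  · exact hΛi.div_const 2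
  · exact (integrable_const (1 : ℝ)).add (hΛi.div_const 2)
  · exact ((integrable_const (1 : ℝ)).add hLi).div_const 4

/-- Two-point lower bound for the mean squared error of an estimate based on `t` observations. -/
theorem two_point_bound (ν : Measure S) [IsProbabilityMeasure ν]
    (μ e : DecisionRules m n S) {θ₀ θ₁ : Param m n} {ρ : Vec m} (hρ : ρ ≠ 0) {g : Vec n → ℝ}
    (hg : Measurable g) (hθ : ∀ x, meanOutput θ₁ x = meanOutput θ₀ x + g x • ρ) (t : ℕ)
    (hinfo : ∫⁻ p, ∑ i ∈ Finset.range t, ENNReal.ofReal (g (output μ μ θ₀ p.1 p.2 i) ^ 2)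
      ∂jointLaw ν (lineGaussian ρ) ≤ 1) (x₀ x₁ : Vec n) :
    ENNReal.ofReal (‖x₁ - x₀‖ ^ 2 / 8) ≤
      ∫⁻ p, ENNReal.ofReal (‖output μ e θ₀ p.1 p.2 t - x₀‖ ^ 2) ∂jointLaw ν (lineGaussian ρ) +
      ∫⁻ p, ENNReal.ofReal (‖output μ e θ₁ p.1 p.2 t - x₁‖ ^ 2)
        ∂jointLaw ν (lineGaussian ρ) := by
  have hG : Measurable fun q : S × (Fin t → Vec n × Vec m) =>
      ENNReal.ofReal (‖e.rule t q.1 q.2 - x₁‖ ^ 2) := by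
    have := e.measurable_rule t
    fun_prop
  have hch := lintegral_history_change ν μ hρ hg hθ t hG
  have hm0 : Measurable fun p : S × (ℕ → Vec m) =>
      ENNReal.ofReal (‖output μ e θ₀ p.1 p.2 t - x₀‖ ^ 2) := by
    have := measurable_output μ e θ₀ t
    fun_prop
  calc ENNReal.ofReal (‖x₁ - x₀‖ ^ 2 / 8)
      = ENNReal.ofReal (‖x₁ - x₀‖ ^ 2 / 2) * ENNReal.ofReal (1 / 4) := by
        rw [← ENNReal.ofReal_mul (by positivity)]; congr 1; ring
    _ ≤ ENNReal.ofReal (‖x₁ - x₀‖ ^ 2 / 2) * ∫⁻ p, ENNReal.ofReal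
          (min 1 (Real.exp (logLikelihood g ρ μ θ₀ t p))) ∂jointLaw ν (lineGaussian ρ) := by
        gcongr
        exact lintegral_min_likelihood_ge ν μ hρ hg hθ t hinfo
    _ = ∫⁻ p, ENNReal.ofReal (‖x₁ - x₀‖ ^ 2 / 2) * ENNReal.ofReal
          (min 1 (Real.exp (logLikelihood g ρ μ θ₀ t p))) ∂jointLaw ν (lineGaussian ρ) := by
        rw [lintegral_const_mul']
        exact ENNReal.ofReal_ne_top
    _ ≤ ∫⁻ p, (ENNReal.ofReal (‖output μ e θ₀ p.1 p.2 t - x₀‖ ^ 2) +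
          ENNReal.ofReal (‖output μ e θ₀ p.1 p.2 t - x₁‖ ^ 2) *
            ENNReal.ofReal (Real.exp (logLikelihood g ρ μ θ₀ t p)))
          ∂jointLaw ν (lineGaussian ρ) := by
        refine lintegral_mono fun p => ?_
        rw [← ENNReal.ofReal_mul (by positivity), ← ENNReal.ofReal_mul (by positivity),
          ← ENNReal.ofReal_add (by positivity) (by positivity)]
        refine ENNReal.ofReal_le_ofReal ?_
        set y := output μ e θ₀ p.1 p.2 t
        set L := Real.exp (logLikelihood g ρ μ θ₀ t p)
        have htri : ‖x₁ - x₀‖ ^ 2 / 2 ≤ ‖y - x₀‖ ^ 2 + ‖y - x₁‖ ^ 2 := by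
          have h : ‖x₁ - x₀‖ ≤ ‖y - x₀‖ + ‖y - x₁‖ := by
            have := norm_sub_le (y - x₀) (y - x₁)
            rwa [sub_sub_sub_cancel_left] at this
          nlinarith [norm_nonneg (x₁ - x₀), norm_nonneg (y - x₀), norm_nonneg (y - x₁),
            sq_nonneg (‖y - x₀‖ - ‖y - x₁‖)]
        -- Both weights `1` and `L` are lowered to their minimum, so that the triangle inequality
        -- applies to the two errors under a common weight.
        have hk0 : 0 ≤ min 1 L := le_min zero_le_one (Real.exp_nonneg _)
        calc ‖x₁ - x₀‖ ^ 2 / 2 * min 1 L ≤ (‖y - x₀‖ ^ 2 + ‖y - x₁‖ ^ 2) * min 1 L := by gcongr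
          _ = ‖y - x₀‖ ^ 2 * min 1 L + ‖y - x₁‖ ^ 2 * min 1 L := by ring
          _ ≤ ‖y - x₀‖ ^ 2 * 1 + ‖y - x₁‖ ^ 2 * L := by
            gcongr
            · exact min_le_left _ _
            · exact min_le_right _ _
          _ = _ := by ring
    _ = _ := by
        rw [lintegral_add_left hm0]
        congr 1
        exact hch.symm

end ChangeOfMeasure

/-! ### Least-squares geometry and the hard curve of parameters. -/

section Geometry

variable {m n : ℕ}

theorem isUnit_det_transpose_mul_self {A : Matrix (Fin m) (Fin n) ℝ} (hA : A.rank = n) :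
    IsUnit (Aᵀ * A).det := by
  have hr : (Aᵀ * A).rank = n := by rw [Matrix.rank_transpose_mul_self, hA]
  rw [← Matrix.isUnit_iff_isUnit_det, ← Matrix.mulVec_surjective_iff_isUnit]
  exact LinearMap.range_eq_top.1 (Submodule.eq_top_of_finrank_eq
    (S := LinearMap.range (Aᵀ * A).mulVecLin) (by simpa [Matrix.rank] using hr))

theorem ofLp_sub_meanOutput (ystar : Vec m) (θ : Param m n) (x : Vec n) :
    (ystar - meanOutput θ x).ofLp = (ystar - θ.2).ofLp - θ.1 *ᵥ x.ofLp := by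
  simp only [meanOutput, WithLp.ofLp_sub, WithLp.ofLp_add]; abel

/-- The optimal input is characterized by the normal equations. -/
theorem normal_equation_iff (ystar : Vec m) {θ : Param m n} (hθ : θ.1.rank = n) (x : Vec n) :
    θ.1ᵀ *ᵥ (ystar - meanOutput θ x).ofLp = 0 ↔ optimalInput ystar θ = x := by
  have hu := isUnit_det_transpose_mul_self hθ
  rw [ofLp_sub_meanOutput, Matrix.mulVec_sub, sub_eq_zero, Matrix.mulVec_mulVec]
  constructor
  · intro h
    rw [optimalInput, h, Matrix.mulVec_mulVec, Matrix.nonsing_inv_mul _ hu, Matrix.one_mulVec]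
  · rintro rfl
    rw [optimalInput, Matrix.mulVec_mulVec, Matrix.mul_nonsing_inv _ hu, Matrix.one_mulVec]

/-- Pythagoras: by the normal equations the residual at the optimum is orthogonal to the range of
the matrix. -/
theorem stageCost_eq_add {σ : ℝ} (ystar : Vec m) {θ : Param m n} (hθ : θ.1.rank = n)
    {F : ProbabilityMeasure (Vec m)} (hF : F ∈ noiseLaws m σ) (x : Vec n) :
    stageCost ystar θ F x = stageCost ystar θ F (optimalInput ystar θ) +
      ‖WithLp.toLp 2 (θ.1 *ᵥ (x - optimalInput ystar θ).ofLp)‖ ^ 2 := by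
  rw [stageCost_eq ystar θ hF, stageCost_eq ystar θ hF]
  set z := optimalInput ystar θ with hz
  have hfoc : θ.1ᵀ *ᵥ (ystar - meanOutput θ z).ofLp = 0 := (normal_equation_iff ystar hθ z).2 rfl
  have hdiff : ystar - meanOutput θ x =
      (ystar - meanOutput θ z) - WithLp.toLp 2 (θ.1 *ᵥ (x - z).ofLp) := by
    simp only [meanOutput, WithLp.ofLp_sub, Matrix.mulVec_sub, WithLp.toLp_sub]; abel
  have horth : inner ℝ (ystar - meanOutput θ z) (WithLp.toLp 2 (θ.1 *ᵥ (x - z).ofLp)) = 0 := by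
    rw [EuclideanSpace.inner_eq_star_dotProduct, star_trivial, dotProduct_comm,
      Matrix.dotProduct_mulVec, ← Matrix.mulVec_transpose, hfoc, zero_dotProduct]
  rw [hdiff, norm_sub_sq_real, horth]
  ring

theorem exists_le_norm_mulVec_sq {A : Matrix (Fin m) (Fin n) ℝ} (hA : A.rank = n) :
    ∃ c : ℝ, 0 < c ∧ ∀ x : Vec n, c * ‖x‖ ^ 2 ≤ ‖(WithLp.toLp 2 (A *ᵥ x.ofLp) : Vec m)‖ ^ 2 := by
  let f : Vec n →ₗ[ℝ] Vec m :=
    { toFun := fun x => WithLp.toLp 2 (A *ᵥ x.ofLp)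
      map_add' := fun x y => by simp [Matrix.mulVec_add]
      map_smul' := fun c x => by simp [Matrix.mulVec_smul] }
  have hker : LinearMap.ker f = ⊥ := by
    refine LinearMap.ker_eq_bot'.2 fun x hx => ?_
    have hx0 : A *ᵥ x.ofLp = 0 := congrArg WithLp.ofLp hx
    have h : (Aᵀ * A) *ᵥ x.ofLp = 0 := by rw [← Matrix.mulVec_mulVec, hx0, Matrix.mulVec_zero]
    have hu := isUnit_det_transpose_mul_self hA
    have h2 : x.ofLp = 0 := by
      rw [← Matrix.one_mulVec x.ofLp, ← Matrix.nonsing_inv_mul _ hu, ← Matrix.mulVec_mulVec, h,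
        Matrix.mulVec_zero]
    exact (WithLp.ofLp_injective 2) h2
  obtain ⟨K, hK, hf⟩ := f.exists_antilipschitzWith hker
  refine ⟨((K : ℝ) ^ 2)⁻¹, by positivity, fun x => ?_⟩
  have h := hf.le_mul_dist x 0
  rw [map_zero, dist_zero_right, dist_zero_right] at h
  rw [inv_mul_le_iff₀ (by positivity), ← mul_pow]
  gcongr
  exact h

/-- Perturbation of `θ` by `s ρ vᵀ` that leaves the mean output at `x₀` unchanged. -/
noncomputable def perturb (θ : Param m n) (ρ : Vec m) (v x₀ : Vec n) (s : ℝ) : Param m n :=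
  (θ.1 + s • vecMulVec ρ.ofLp v.ofLp, θ.2 - (s * (v.ofLp ⬝ᵥ x₀.ofLp)) • ρ)

theorem perturb_zero (θ : Param m n) (ρ : Vec m) (v x₀ : Vec n) : perturb θ ρ v x₀ 0 = θ := by
  simp [perturb]

theorem continuous_perturb (θ : Param m n) (ρ : Vec m) (v x₀ : Vec n) :
    Continuous (perturb θ ρ v x₀) := by
  unfold perturb; fun_prop

theorem perturb_mulVec (θ : Param m n) (ρ : Vec m) (v x₀ : Vec n) (s : ℝ) (x : Fin n → ℝ) :
    (perturb θ ρ v x₀ s).1 *ᵥ x = θ.1 *ᵥ x + (s * (v.ofLp ⬝ᵥ x)) • ρ.ofLp := by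
  simp [perturb, Matrix.add_mulVec, Matrix.smul_mulVec, vecMulVec_mulVec, smul_smul]

theorem meanOutput_perturb (θ : Param m n) (ρ : Vec m) (v x₀ : Vec n) (s : ℝ) (x : Vec n) :
    meanOutput (perturb θ ρ v x₀ s) x = meanOutput θ x + (s * inner ℝ v (x - x₀)) • ρ := by
  have h : (inner ℝ v (x - x₀) : ℝ) = v.ofLp ⬝ᵥ x.ofLp - v.ofLp ⬝ᵥ x₀.ofLp := by
    rw [EuclideanSpace.inner_eq_star_dotProduct, star_trivial, WithLp.ofLp_sub, sub_dotProduct,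
      dotProduct_comm, dotProduct_comm x₀.ofLp]
  rw [h, meanOutput, perturb_mulVec, meanOutput, WithLp.toLp_add, WithLp.toLp_smul,
    WithLp.toLp_ofLp]
  simp only [perturb]
  module

/-- Along a suitable perturbation the optimal input moves along a straight line. -/
theorem optimalInput_perturb {ystar : Vec m} {θ : Param m n} {x₀ : Vec n} {ρ : Vec m}
    (hρ : ρ = ystar - meanOutput θ x₀) (horth : θ.1ᵀ *ᵥ ρ.ofLp = 0) {q v : Vec n}
    (hv : v.ofLp = θ.1ᵀ *ᵥ (θ.1 *ᵥ q.ofLp)) {s : ℝ}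
    (hrank : (perturb θ ρ v x₀ s).1.rank = n) :
    optimalInput ystar (perturb θ ρ v x₀ s) =
      x₀ + (s * ‖ρ‖ ^ 2 / (1 + s ^ 2 * ‖ρ‖ ^ 2 *
        ‖(WithLp.toLp 2 (θ.1 *ᵥ q.ofLp) : Vec m)‖ ^ 2)) • q := by
  set a : Fin m → ℝ := θ.1 *ᵥ q.ofLp with ha
  have hN : ‖ρ‖ ^ 2 = ρ.ofLp ⬝ᵥ ρ.ofLp := by
    rw [← real_inner_self_eq_norm_sq, EuclideanSpace.inner_eq_star_dotProduct, star_trivial]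
  have hk : ‖(WithLp.toLp 2 a : Vec m)‖ ^ 2 = a ⬝ᵥ a := by
    rw [← real_inner_self_eq_norm_sq, EuclideanSpace.inner_eq_star_dotProduct, star_trivial]
  have hvq : v.ofLp ⬝ᵥ q.ofLp = ‖(WithLp.toLp 2 a : Vec m)‖ ^ 2 := by
    rw [hk, hv, Matrix.mulVec_transpose, ← Matrix.dotProduct_mulVec]
  have hρa : ρ.ofLp ⬝ᵥ a = 0 := by
    rw [ha, Matrix.dotProduct_mulVec, ← Matrix.mulVec_transpose, horth, zero_dotProduct]
  have hT : ∀ y : Fin m → ℝ, (perturb θ ρ v x₀ s).1ᵀ *ᵥ y =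
      θ.1ᵀ *ᵥ y + (s * (ρ.ofLp ⬝ᵥ y)) • v.ofLp := by
    intro y
    simp [perturb, Matrix.add_mulVec, Matrix.smul_mulVec, transpose_vecMulVec, vecMulVec_mulVec,
      smul_smul]
  set N := ‖ρ‖ ^ 2
  set k := ‖(WithLp.toLp 2 a : Vec m)‖ ^ 2
  set c := s * N / (1 + s ^ 2 * N * k) with hc
  have hden : 0 < 1 + s ^ 2 * N * k := by positivity
  have hceq : c * (1 + s ^ 2 * N * k) = s * N := div_mul_cancel₀ _ hden.ne'
  refine (normal_equation_iff ystar hrank _).1 ?_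
  have hres : (ystar - meanOutput (perturb θ ρ v x₀ s) (x₀ + c • q)).ofLp =
      (1 - s * c * k) • ρ.ofLp - c • a := by
    have h1 : meanOutput θ (x₀ + c • q) = meanOutput θ x₀ + c • WithLp.toLp 2 a := by
      simp only [meanOutput, WithLp.ofLp_add, WithLp.ofLp_smul, Matrix.mulVec_add,
        Matrix.mulVec_smul, WithLp.toLp_add, WithLp.toLp_smul, ← ha]
      abel
    have h2 : (inner ℝ v (c • q) : ℝ) = c * k := by
      rw [inner_smul_right, EuclideanSpace.inner_eq_star_dotProduct, star_trivial,
        dotProduct_comm, hvq]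
    have h3 : ystar - meanOutput (perturb θ ρ v x₀ s) (x₀ + c • q) =
        (1 - s * c * k) • ρ - c • WithLp.toLp 2 a := by
      rw [meanOutput_perturb, h1, add_sub_cancel_left, h2]
      have : ystar = ρ + meanOutput θ x₀ := by rw [hρ]; abel
      rw [this]
      module
    rw [h3]; rfl
  rw [hres, hT, Matrix.mulVec_sub, Matrix.mulVec_smul, Matrix.mulVec_smul, horth, ← hv,
    dotProduct_sub, dotProduct_smul, dotProduct_smul, hρa, ← hN, smul_zero, zero_sub, ← neg_smul,
    ← add_smul]
  -- Both parts of the normal equations are multiples of `v`: this is the total coefficient, and the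
  -- value of `c` is the one that annihilates it.
  have : -c + s * ((1 - s * c * k) • N - c • (0 : ℝ)) = 0 := by
    simp only [smul_eq_mul]; linarith
  rw [this, zero_smul]

/-- The added rank-one term points along `ρ`, orthogonal to the range of the original matrix, so
norms can only grow. One lower constant thus serves the whole curve, which the regret bound needs.
-/
theorem norm_perturb_mulVec_sq_ge {θ : Param m n} {ρ : Vec m}
    (horth : θ.1ᵀ *ᵥ ρ.ofLp = 0) (v x₀ : Vec n) (s : ℝ) (x : Vec n) :
    ‖(WithLp.toLp 2 (θ.1 *ᵥ x.ofLp) : Vec m)‖ ^ 2 ≤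
      ‖(WithLp.toLp 2 ((perturb θ ρ v x₀ s).1 *ᵥ x.ofLp) : Vec m)‖ ^ 2 := by
  have h : inner ℝ (WithLp.toLp 2 (θ.1 *ᵥ x.ofLp) : Vec m) ρ = 0 := by
    rw [EuclideanSpace.inner_eq_star_dotProduct, star_trivial,
      Matrix.dotProduct_mulVec, ← Matrix.mulVec_transpose, horth, zero_dotProduct]
  rw [perturb_mulVec, WithLp.toLp_add, WithLp.toLp_smul, WithLp.toLp_ofLp, norm_add_sq_real,
    inner_smul_right, h]
  nlinarith [sq_nonneg ‖(s * (v.ofLp ⬝ᵥ x.ofLp)) • ρ‖]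

/-- When there are more outputs than inputs, some interior parameter has a nonzero residual at the
optimal input. -/
theorem exists_interior_residual_ne_zero (hmn : n < m) (ystar : Vec m) {D : Set (Vec n)}
    {Θ : Set (Param m n)} (hint : (interior (admissibleParams ystar D Θ)).Nonempty) :
    ∃ θ ∈ interior (admissibleParams ystar D Θ),
      ystar - meanOutput θ (optimalInput ystar θ) ≠ 0 := by
  obtain ⟨θ, hθ⟩ := hint
  by_cases hres : ystar - meanOutput θ (optimalInput ystar θ) = 0
  swap
  · exact ⟨θ, hθ, hres⟩
  -- Since `n < m`, the transpose has a nonzero kernel vector `u`. Moving `b` along `u` keeps the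
  -- optimal input and makes the residual nonzero.
  obtain ⟨u, hu, hu0⟩ := Submodule.exists_mem_ne_zero_of_ne_bot
    (LinearMap.ker_ne_bot_of_finrank_lt (f := θ.1ᵀ.mulVecLin) (by simpa using hmn))
  rw [LinearMap.mem_ker, Matrix.mulVecLin_apply] at hu
  have hcont : Continuous fun ε : ℝ => ((θ.1, θ.2 + ε • WithLp.toLp 2 u) : Param m n) := by
    fun_prop
  have hev : ∀ᶠ ε in nhds (0 : ℝ), ((θ.1, θ.2 + ε • WithLp.toLp 2 u) : Param m n) ∈
      interior (admissibleParams ystar D Θ) := by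
    refine hcont.continuousAt.eventually (isOpen_interior.mem_nhds ?_)
    simpa using hθ
  obtain ⟨ε, hε, hε0⟩ := ((hev.filter_mono nhdsWithin_le_nhds).and
    (eventually_mem_nhdsWithin (s := {(0 : ℝ)}ᶜ))).exists
  refine ⟨_, hε, ?_⟩
  have hr : ystar - meanOutput (θ.1, θ.2 + ε • WithLp.toLp 2 u) (optimalInput ystar θ) =
      -(ε • WithLp.toLp 2 u) := by
    have h : ∀ y : Vec m, meanOutput (θ.1, θ.2 + y) (optimalInput ystar θ) =
        meanOutput θ (optimalInput ystar θ) + y := fun y => by simp only [meanOutput, add_assoc]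
    rw [h, ← sub_sub, hres, zero_sub]
  have hx : optimalInput ystar (θ.1, θ.2 + ε • WithLp.toLp 2 u) = optimalInput ystar θ := by
    refine (normal_equation_iff ystar (interior_subset hε).2.1 _).1 ?_
    rw [hr]
    simp [Matrix.mulVec_neg, Matrix.mulVec_smul, hu]
  rw [hx, hr]
  simpa using ⟨hε0, hu0⟩

/-- A curve of admissible parameters along which the optimal input moves at a linear rate while
the mean output changes only in proportion to the distance from the optimal input. -/
theorem exists_hard_curve (hn : 0 < n) (hmn : n < m) (ystar : Vec m) {D : Set (Vec n)}
    {Θ : Set (Param m n)} (hint : (interior (admissibleParams ystar D Θ)).Nonempty) :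
    ∃ (θ : ℝ → Param m n) (ρ : Vec m) (v : Vec n) (s₀ c l : ℝ), ρ ≠ 0 ∧ 0 < s₀ ∧ 0 < c ∧ 0 < l ∧
      ∀ s, 0 ≤ s → s ≤ s₀ → θ s ∈ admissibleParams ystar D Θ ∧
        (∀ x, meanOutput (θ s) x = meanOutput (θ 0) x +
          (s * inner ℝ v (x - optimalInput ystar (θ 0))) • ρ) ∧
        c * s ≤ ‖optimalInput ystar (θ s) - optimalInput ystar (θ 0)‖ ∧
        ∀ x : Vec n, l * ‖x‖ ^ 2 ≤ ‖(WithLp.toLp 2 ((θ s).1 *ᵥ x.ofLp) : Vec m)‖ ^ 2 := by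
  obtain ⟨θ, hθ, hres⟩ := exists_interior_residual_ne_zero hmn ystar hint
  have hrank : θ.1.rank = n := (interior_subset hθ).2.1
  set x₀ := optimalInput ystar θ with hx₀
  set ρ := ystar - meanOutput θ x₀ with hρ
  have horth : θ.1ᵀ *ᵥ ρ.ofLp = 0 := (normal_equation_iff ystar hrank x₀).2 rfl
  obtain ⟨l, hl, hlA⟩ := exists_le_norm_mulVec_sq hrank
  have : Nonempty (Fin n) := ⟨⟨0, hn⟩⟩
  obtain ⟨q, hq⟩ := exists_ne (0 : Vec n)
  set v : Vec n := WithLp.toLp 2 (θ.1ᵀ *ᵥ (θ.1 *ᵥ q.ofLp)) with hv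
  have hev : ∀ᶠ s in nhds (0 : ℝ), perturb θ ρ v x₀ s ∈ interior (admissibleParams ystar D Θ) := by
    refine (continuous_perturb θ ρ v x₀).continuousAt.eventually (isOpen_interior.mem_nhds ?_)
    rwa [perturb_zero]
  obtain ⟨r, hr, hball⟩ := Metric.eventually_nhds_iff.1 hev
  set k := ‖(WithLp.toLp 2 (θ.1 *ᵥ q.ofLp) : Vec m)‖ ^ 2 with hk
  have hρ0 : 0 < ‖ρ‖ := norm_pos_iff.2 hres
  have hq0 : 0 < ‖q‖ := norm_pos_iff.2 hq
  -- The bound `s ≤ 1` makes the displacement rate at least its value with `s ^ 2` replaced by `1`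
  -- in the denominator; `r / 2` keeps `s` strictly inside the ball.
  refine ⟨perturb θ ρ v x₀, ρ, v, min 1 (r / 2), ‖ρ‖ ^ 2 / (1 + ‖ρ‖ ^ 2 * k) * ‖q‖, l, hres,
    by positivity, by positivity, hl, fun s hs hs0 => ?_⟩
  have hs1 : s ≤ 1 := hs0.trans (min_le_left _ _)
  have hadm : perturb θ ρ v x₀ s ∈ admissibleParams ystar D Θ := by
    refine interior_subset (hball ?_)
    rw [Real.dist_eq, sub_zero, abs_of_nonneg hs]
    linarith [hs0.trans (min_le_right _ _)]
  refine ⟨hadm, ?_, ?_, fun x => ?_⟩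
  · rw [perturb_zero]
    exact meanOutput_perturb θ ρ v x₀ s
  · rw [perturb_zero, ← hx₀, optimalInput_perturb hρ horth rfl hadm.2.1, add_sub_cancel_left,
      norm_smul, ← hk, Real.norm_of_nonneg (by positivity), mul_right_comm]
    gcongr
    rw [div_mul_eq_mul_div, mul_comm s]
    have hs2 : s ^ 2 ≤ 1 := pow_le_one₀ hs hs1
    have : s ^ 2 * ‖ρ‖ ^ 2 * k ≤ 1 * ‖ρ‖ ^ 2 * k := by gcongr
    exact div_le_div_of_nonneg_left (by positivity) (by positivity) (by linarith)
  · exact (hlA x).trans (norm_perturb_mulVec_sq_ge horth v x₀ s x)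

end Geometry

/-! ### From indistinguishability to the product bound and the regret. -/

section LowerBound

variable {m n : ℕ} {S : Type*} [MeasurableSpace S]

theorem measurable_sqError (ystar : Vec m) (μ e : DecisionRules m n S) (θ θ' : Param m n)
    (t : ℕ) : Measurable fun p : S × (ℕ → Vec m) =>
      ENNReal.ofReal (‖output μ e θ p.1 p.2 t - optimalInput ystar θ'‖ ^ 2) := by
  have := measurable_output μ e θ t
  fun_prop

theorem cumulativeMSE_eq_sum (ystar : Vec m) (ν : Measure S) (μ e : DecisionRules m n S) (T : ℕ)
    (θ : Param m n) (F : ProbabilityMeasure (Vec m)) :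
    cumulativeMSE ystar ν μ e T θ F = ∑ t ∈ Finset.range T,
      ∫⁻ p, ENNReal.ofReal (‖output μ e θ p.1 p.2 t - optimalInput ystar θ‖ ^ 2) ∂jointLaw ν F :=
  lintegral_finsetSum _ fun t _ => measurable_sqError ystar μ e θ θ t

theorem cumulativeMSE_mono (ystar : Vec m) (ν : Measure S) (μ e : DecisionRules m n S) {t T : ℕ}
    (h : t ≤ T) (θ : Param m n) (F : ProbabilityMeasure (Vec m)) :
    cumulativeMSE ystar ν μ e t θ F ≤ cumulativeMSE ystar ν μ e T θ F := by
  rw [cumulativeMSE_eq_sum, cumulativeMSE_eq_sum]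
  exact Finset.sum_le_sum_of_subset (Finset.range_subset_range.2 h)

/-- Two-point bound for systems whose mean outputs differ by a multiple of the distance from the
optimal input of the first one. -/
theorem mse_add_mse_ge (ystar : Vec m) (ν : Measure S) [IsProbabilityMeasure ν]
    (μ e : DecisionRules m n S) {θ₀ θ₁ : Param m n} {ρ : Vec m} (hρ : ρ ≠ 0) {v : Vec n} {s : ℝ}
    (hθ : ∀ x, meanOutput θ₁ x =
      meanOutput θ₀ x + (s * inner ℝ v (x - optimalInput ystar θ₀)) • ρ) (t : ℕ)
    (hinfo : ENNReal.ofReal (s ^ 2 * ‖v‖ ^ 2) *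
      cumulativeMSE ystar ν μ μ t θ₀ (lineGaussian ρ) ≤ 1) :
    ENNReal.ofReal (‖optimalInput ystar θ₁ - optimalInput ystar θ₀‖ ^ 2 / 8) ≤
      ∫⁻ p, ENNReal.ofReal (‖output μ e θ₀ p.1 p.2 t - optimalInput ystar θ₀‖ ^ 2)
        ∂jointLaw ν (lineGaussian ρ) +
      ∫⁻ p, ENNReal.ofReal (‖output μ e θ₁ p.1 p.2 t - optimalInput ystar θ₁‖ ^ 2)
        ∂jointLaw ν (lineGaussian ρ) := by
  refine two_point_bound ν μ e hρ (g := fun x => s * inner ℝ v (x - optimalInput ystar θ₀))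
    (by fun_prop) hθ t (le_trans ?_ hinfo) _ _
  rw [cumulativeMSE, ← lintegral_const_mul' _ _ ENNReal.ofReal_ne_top]
  refine lintegral_mono fun p => ?_
  rw [Finset.mul_sum]
  refine Finset.sum_le_sum fun i _ => ?_
  rw [← ENNReal.ofReal_mul (by positivity)]
  refine ENNReal.ofReal_le_ofReal ?_
  set y := output μ μ θ₀ p.1 p.2 i - optimalInput ystar θ₀
  have h : (inner ℝ v y : ℝ) ^ 2 ≤ (‖v‖ * ‖y‖) ^ 2 :=
    sq_le_sq' (neg_le_of_abs_le (abs_real_inner_le_norm v y)) (real_inner_le_norm v y)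
  calc (s * inner ℝ v y) ^ 2 = s ^ 2 * (inner ℝ v y : ℝ) ^ 2 := by ring
    _ ≤ s ^ 2 * (‖v‖ * ‖y‖) ^ 2 := by gcongr
    _ = s ^ 2 * ‖v‖ ^ 2 * ‖y‖ ^ 2 := by ring

/-- The product bound along a curve of systems that are hard to tell apart. -/
theorem mse_mul_mse_ge (ystar : Vec m) (ν : Measure S) [IsProbabilityMeasure ν]
    (μ e : DecisionRules m n S) {θ : ℝ → Param m n} {ρ : Vec m} (hρ : ρ ≠ 0) {v : Vec n}
    {s₀ c K : ℝ} (hs₀ : 0 < s₀) (hc : 0 < c) (hK : 0 < K) (hvK : ‖v‖ ^ 2 ≤ K)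
    (hθ : ∀ s, 0 ≤ s → s ≤ s₀ → ∀ x, meanOutput (θ s) x = meanOutput (θ 0) x +
      (s * inner ℝ v (x - optimalInput ystar (θ 0))) • ρ)
    (hx : ∀ s, 0 ≤ s → s ≤ s₀ →
      c * s ≤ ‖optimalInput ystar (θ s) - optimalInput ystar (θ 0)‖) (T : ℕ) {X Y : ℝ≥0∞}
    (hX : ∀ s, 0 ≤ s → s ≤ s₀ → cumulativeMSE ystar ν μ μ T (θ s) (lineGaussian ρ) ≤ X)
    (hY : ∀ s, 0 ≤ s → s ≤ s₀ → cumulativeMSE ystar ν μ e T (θ s) (lineGaussian ρ) ≤ Y) :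
    ENNReal.ofReal (c ^ 2 / 16 * min K⁻¹ (s₀ ^ 2 * (c ^ 2 * s₀ ^ 2 / 16)) * T) ≤ Y * X := by
  have hstep : ∀ (e : DecisionRules m n S) (s : ℝ), 0 ≤ s → s ≤ s₀ → ∀ t,
      ENNReal.ofReal (s ^ 2 * K) * cumulativeMSE ystar ν μ μ t (θ 0) (lineGaussian ρ) ≤ 1 →
      ENNReal.ofReal (c ^ 2 * s ^ 2 / 8) ≤
        ∫⁻ p, ENNReal.ofReal (‖output μ e (θ 0) p.1 p.2 t - optimalInput ystar (θ 0)‖ ^ 2)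
          ∂jointLaw ν (lineGaussian ρ) +
        ∫⁻ p, ENNReal.ofReal (‖output μ e (θ s) p.1 p.2 t - optimalInput ystar (θ s)‖ ^ 2)
          ∂jointLaw ν (lineGaussian ρ) := by
    intro e s hs hss t hinfo
    refine le_trans (ENNReal.ofReal_le_ofReal ?_) (mse_add_mse_ge ystar ν μ e hρ (hθ s hs hss) t
      (le_trans ?_ hinfo))
    · rw [← mul_pow]
      have := hx s hs hss
      gcongr
    · gcongr
  rcases Nat.eq_zero_or_pos T with rfl | hT
  · simp
  set c₁ : ℝ := c ^ 2 * s₀ ^ 2 / 16 with hc₁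
  have hc₁0 : 0 < c₁ := by positivity
  -- without any observation, the error is bounded below
  have hfirst : ∀ (e : DecisionRules m n S) (Z : ℝ≥0∞),
      (∀ s, 0 ≤ s → s ≤ s₀ → cumulativeMSE ystar ν μ e T (θ s) (lineGaussian ρ) ≤ Z) →
      ENNReal.ofReal c₁ ≤ Z := by
    intro e Z hZ
    -- At `t = 0` the information is an empty sum, so even the largest parameter gap `s₀` is
    -- allowed.
    have h := hstep e s₀ hs₀.le le_rfl 0 (by simp [cumulativeMSE])
    have h1 : ∀ s, 0 ≤ s → s ≤ s₀ →
        ∫⁻ p, ENNReal.ofReal (‖output μ e (θ s) p.1 p.2 0 - optimalInput ystar (θ s)‖ ^ 2)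
          ∂jointLaw ν (lineGaussian ρ) ≤ Z := by
      intro s hs hss
      refine le_trans ?_ ((cumulativeMSE_mono ystar ν μ e hT (θ s) (lineGaussian ρ)).trans
        (hZ s hs hss))
      rw [cumulativeMSE_eq_sum]; simp
    have h2 := h.trans (add_le_add (h1 0 le_rfl hs₀.le) (h1 s₀ hs₀.le le_rfl))
    have h3 : ENNReal.ofReal (c ^ 2 * s₀ ^ 2 / 8) = 2 * ENNReal.ofReal c₁ := by
      rw [← ENNReal.ofReal_ofNat 2, ← ENNReal.ofReal_mul (by norm_num)]
      congr 1; rw [hc₁]; ring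
    rw [h3, ← two_mul] at h2
    exact (ENNReal.mul_le_mul_iff_right two_ne_zero ENNReal.ofNat_ne_top).1 h2
  have hXc := hfirst μ X hX
  have hYc := hfirst e Y hY
  have hpos : 0 < ENNReal.ofReal c₁ := ENNReal.ofReal_pos.2 hc₁0
  rcases eq_or_ne X ⊤ with hXt | hXt
  · rw [hXt, ENNReal.mul_top (hpos.trans_le hYc).ne']; exact le_top
  rcases eq_or_ne Y ⊤ with hYt | hYt
  · rw [hYt, ENNReal.top_mul (hpos.trans_le hXc).ne']; exact le_top
  lift X to NNReal using hXt
  lift Y to NNReal using hYt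
  have ha : c₁ ≤ (X : ℝ) := by
    rw [ENNReal.ofReal, ENNReal.coe_le_coe] at hXc
    exact Real.toNNReal_le_iff_le_coe.1 hXc
  have ha0 : 0 < (X : ℝ) := hc₁0.trans_le ha
  -- With `s ^ 2 = κ / X`, the bound `κ ≤ K⁻¹` keeps the information below `1`, and `κ ≤ s₀ ^ 2 *
  -- c₁` together with `c₁ ≤ X` keeps `s ≤ s₀`.
  set κ := min K⁻¹ (s₀ ^ 2 * c₁) with hκ
  have hκ0 : 0 < κ := lt_min (by positivity) (by positivity)
  set s := √(κ / X) with hs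
  have hs2 : s ^ 2 = κ / X := Real.sq_sqrt (by positivity)
  have hss : s ≤ s₀ := by
    refine Real.sqrt_le_iff.2 ⟨hs₀.le, (div_le_iff₀ ha0).2 ?_⟩
    exact (min_le_right _ _).trans (by gcongr)
  have hs0 : 0 ≤ s := Real.sqrt_nonneg _
  have hinfo : ∀ t ∈ Finset.range T, ENNReal.ofReal (s ^ 2 * K) *
      cumulativeMSE ystar ν μ μ t (θ 0) (lineGaussian ρ) ≤ 1 := by
    intro t ht
    have h1 := (cumulativeMSE_mono ystar ν μ μ (Finset.mem_range.1 ht).le (θ 0)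
      (lineGaussian ρ)).trans (hX 0 le_rfl hs₀.le)
    calc _ ≤ ENNReal.ofReal (s ^ 2 * K) * (X : ℝ≥0∞) := by gcongr
      _ = ENNReal.ofReal (s ^ 2 * K * X) := by
        rw [ENNReal.ofReal_mul (p := s ^ 2 * K) (by positivity), ENNReal.ofReal_coe_nnreal]
      _ ≤ 1 := by
        rw [ENNReal.ofReal_le_one, hs2]
        have : κ * K ≤ 1 := by
          calc κ * K ≤ K⁻¹ * K := by gcongr; exact min_le_left _ _
            _ = 1 := inv_mul_cancel₀ hK.ne'
        calc κ / X * K * X = κ * K := by field_simp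
          _ ≤ 1 := this
  -- The same `s` serves all `T` periods, because the information before each of them is bounded
  -- through the full-horizon error `X`.
  have hsum := Finset.sum_le_sum fun t ht => hstep e s hs0 hss t (hinfo t ht)
  rw [Finset.sum_add_distrib, ← cumulativeMSE_eq_sum, ← cumulativeMSE_eq_sum, Finset.sum_const,
    Finset.card_range, nsmul_eq_mul] at hsum
  have h2 := hsum.trans (add_le_add (hY 0 le_rfl hs₀.le) (hY s hs0 hss))
  rw [← ENNReal.ofReal_natCast, ← ENNReal.ofReal_mul (by positivity), ← ENNReal.coe_add,
    ENNReal.ofReal, ENNReal.coe_le_coe, Real.toNNReal_le_iff_le_coe, NNReal.coe_add, hs2] at h2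
  rw [← ENNReal.coe_mul, ENNReal.ofReal, ENNReal.coe_le_coe, Real.toNNReal_le_iff_le_coe,
    NNReal.coe_mul]
  calc c ^ 2 / 16 * κ * T = (T * (c ^ 2 * (κ / (X : ℝ)) / 8)) / 2 * (X : ℝ) := by
        field_simp; ring
    _ ≤ ((Y : ℝ) + Y) / 2 * X := by gcongr
    _ = (Y : ℝ) * X := by ring

/-- The regret dominates the input error. -/
theorem mul_cumulativeMSE_le_regret {σ : ℝ} (ystar : Vec m) (ν : Measure S)
    (μ : DecisionRules m n S) (T : ℕ) {θ : Param m n} (hθ : θ.1.rank = n)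
    {F : ProbabilityMeasure (Vec m)} (hF : F ∈ noiseLaws m σ) {l : ℝ} (hl : 0 ≤ l)
    (hθl : ∀ x : Vec n, l * ‖x‖ ^ 2 ≤ ‖(WithLp.toLp 2 (θ.1 *ᵥ x.ofLp) : Vec m)‖ ^ 2) :
    ENNReal.ofReal l * cumulativeMSE ystar ν μ μ T θ F ≤ regret ystar ν μ T θ F := by
  rw [cumulativeMSE, regret, ← lintegral_const_mul' _ _ ENNReal.ofReal_ne_top]
  refine lintegral_mono fun p => ?_
  rw [← ENNReal.ofReal_sum_of_nonneg fun _ _ => by positivity, ← ENNReal.ofReal_mul hl,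
    ← Finset.sum_sub_distrib, Finset.mul_sum]
  refine ENNReal.ofReal_le_ofReal (Finset.sum_le_sum fun t _ => ?_)
  rw [stageCost_eq_add ystar hθ hF (output μ μ θ p.1 p.2 t), add_sub_cancel_left]
  exact hθl _

theorem ofReal_sqrt_mul_sqrt_le {C : ℝ} (hC : 0 ≤ C) (T : ℕ) {X : ℝ≥0∞}
    (h : ENNReal.ofReal (C * T) ≤ X * X) : ENNReal.ofReal (√C * √(T : ℝ)) ≤ X := by
  refine le_of_not_gt fun hlt => (ENNReal.mul_lt_mul hlt hlt).not_ge ?_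
  rwa [← ENNReal.ofReal_mul (by positivity), mul_mul_mul_comm, Real.mul_self_sqrt hC,
    Real.mul_self_sqrt (Nat.cast_nonneg T)]

end LowerBound

end AffineRegulation

open AffineRegulation in
theorem mainTheorem5 (m n : ℕ) (hn : 0 < n) (hmn : n < m)
    (ystar : AffineRegulation.Vec m)
    (D : Set (AffineRegulation.Vec n)) (hD : IsCompact D) (hDconv : Convex ℝ D)
    (Θ : Set (AffineRegulation.Param m n)) (hΘ : IsCompact Θ)
    (hint : (interior (AffineRegulation.admissibleParams ystar D Θ)).Nonempty)
    (σ : ℝ) (hσ : 0 < σ) :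
    ∃ C C' C'' : ℝ, 0 < C ∧ 0 < C' ∧ 0 < C'' ∧
      ∀ (S : Type*) [MeasurableSpace S] (ν : Measure S) [IsProbabilityMeasure ν]
        (μ : AffineRegulation.DecisionRules m n S) (T : ℕ),
        (∀ e : AffineRegulation.DecisionRules m n S,
          ENNReal.ofReal (C * T) ≤
            AffineRegulation.worstEstimationMSE ystar D Θ σ ν μ e T *
              AffineRegulation.worstInputMSE ystar D Θ σ ν μ T) ∧
        ENNReal.ofReal (C' * √(T : ℝ)) ≤ AffineRegulation.worstInputMSE ystar D Θ σ ν μ T ∧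
        ENNReal.ofReal (C'' * √(T : ℝ)) ≤ AffineRegulation.worstRegret ystar D Θ σ ν μ T := by
  obtain ⟨θ, ρ, v, s₀, c, l, hρ, hs₀, hc, hl, hcurve⟩ := exists_hard_curve hn hmn ystar hint
  obtain ⟨τ, hτ, hF⟩ := exists_lineGaussian_mem_noiseLaws ρ hσ
  have hτρ : τ • ρ ≠ 0 := smul_ne_zero hτ.ne' hρ
  -- The noise has scale `τ • ρ`, so the shift is expressed in that unit and `v` is rescaled by
  -- `τ⁻¹`.
  have hmean : ∀ s, 0 ≤ s → s ≤ s₀ → ∀ x, meanOutput (θ s) x = meanOutput (θ 0) x +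
      (s * inner ℝ (τ⁻¹ • v) (x - optimalInput ystar (θ 0))) • (τ • ρ) := by
    intro s hs hss x
    rw [(hcurve s hs hss).2.1 x, real_inner_smul_left, smul_smul]
    congr 2
    field_simp
  set K : ℝ := 1 + ‖τ⁻¹ • v‖ ^ 2 with hK
  set C : ℝ := c ^ 2 / 16 * min K⁻¹ (s₀ ^ 2 * (c ^ 2 * s₀ ^ 2 / 16)) with hCdef
  have hK0 : 0 < K := by positivity
  have hC : 0 < C := mul_pos (by positivity) (lt_min (by positivity) (by positivity))
  -- The last two constants come from the core bound with `e = μ`: there both `X` and `Y` are taken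
  -- to be the worst input error, respectively `l⁻¹` times the worst regret.
  refine ⟨C, √C, l * √C, hC, Real.sqrt_pos.2 hC, mul_pos hl (Real.sqrt_pos.2 hC), ?_⟩
  intro S _ ν _ μ T
  have hcore := fun (e : DecisionRules m n S) (X Y : ℝ≥0∞) => mse_mul_mse_ge ystar ν μ e hτρ hs₀ hc
    hK0 (by rw [hK]; linarith) hmean (fun s hs hss => (hcurve s hs hss).2.2.1) T (X := X) (Y := Y)
  have hE : ∀ (e : DecisionRules m n S) (s : ℝ), 0 ≤ s → s ≤ s₀ →
      cumulativeMSE ystar ν μ e T (θ s) (lineGaussian (τ • ρ)) ≤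
        worstEstimationMSE ystar D Θ σ ν μ e T := fun e s hs hss =>
    le_iSup₂_of_le (θ s) (hcurve s hs hss).1 (le_iSup₂_of_le _ hF le_rfl)
  have hR : ∀ s, 0 ≤ s → s ≤ s₀ →
      cumulativeMSE ystar ν μ μ T (θ s) (lineGaussian (τ • ρ)) ≤
        ENNReal.ofReal l⁻¹ * worstRegret ystar D Θ σ ν μ T := by
    intro s hs hss
    obtain ⟨hadm, -, -, hsl⟩ := hcurve s hs hss
    have h := (mul_cumulativeMSE_le_regret ystar ν μ T hadm.2.1 hF hl.le hsl).trans
      (le_iSup₂_of_le (θ s) hadm (le_iSup₂_of_le _ hF le_rfl) :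
        _ ≤ worstRegret ystar D Θ σ ν μ T)
    calc _ = ENNReal.ofReal l⁻¹ * (ENNReal.ofReal l *
          cumulativeMSE ystar ν μ μ T (θ s) (lineGaussian (τ • ρ))) := by
          rw [← mul_assoc, ← ENNReal.ofReal_mul (by positivity), inv_mul_cancel₀ hl.ne',
            ENNReal.ofReal_one, one_mul]
      _ ≤ _ := by gcongr; exact h
  refine ⟨fun e => hcore e _ _ (hE μ) (hE e), ?_, ?_⟩
  · exact ofReal_sqrt_mul_sqrt_le hC.le T (hcore μ _ _ (hE μ) (hE μ))
  · have h := ofReal_sqrt_mul_sqrt_le hC.le T (hcore μ _ _ hR hR)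
    calc ENNReal.ofReal (l * √C * √(T : ℝ)) = ENNReal.ofReal l * ENNReal.ofReal (√C * √(T : ℝ)) := by
          rw [← ENNReal.ofReal_mul hl.le, mul_assoc]
      _ ≤ ENNReal.ofReal l * (ENNReal.ofReal l⁻¹ * worstRegret ystar D Θ σ ν μ T) := by gcongr
      _ = _ := by
          rw [← mul_assoc, ← ENNReal.ofReal_mul hl.le, mul_inv_cancel₀ hl.ne',
            ENNReal.ofReal_one, one_mul]
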